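/- A diversity is a pair $(X,\delta)$ where $X$ is a set and $\delta$ is a real-valued function on the finite subsets of $X$ such that, for all finite $A,B,C\subseteq X$: $\delta(A)\ge 0$; $\delta(A)=0$ whenever $|A|\le 1$; and $\delta(A\cup C)\le\delta(A\cup B)+\delta(B\cup C)$ whenever $B\neq\emptyset$. (As for pseudometrics, $\delta(A)=0$ is allowed also when $|A|>1$.) A map $\phi:X_1\to X_2$ between diversities $(X_1,\delta_1)$ and $(X_2,\delta_2)$ has distortion $c\ge 1$ if there are $c_1,c_2>0$ with $c=c_1c_2$ and $\frac1{c_1}\delta_1(A)\le\delta_2(\phi(A))\le c_2\,\delta_1(A)$ for all finite $A\subseteq X_1$. On $\mathbb R^k$ consider the $\ell_1$ diversity $\delta_1(A)=\sum_{i=1}^k\max_{a,b\in A}|a_i-b_i|$ and the mean-width diversity $$\delta_w(A)=\frac{\pi}{\mu_k(S^k)}\int_{S^{k-1}}\Bigl(\max_{a\in \mathrm{conv}(A)}a\cdot u-\min_{a\in \mathrm{conv}(A)}a\cdot u\Bigr)\,d\mu_{k-1}(u),$$ where $\mu_{m}$ is the surface measure on the unit sphere $S^{m}\subset\mathbb R^{m+1}$;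 both are $0$ for $A=\emptyset$. Theorem. There is an absolute constant $C>0$ such that for every $n\ge 2$ and every diversity $(X,\delta)$ with $|X|=n$: 1. for some $k\le C\log n$ there is a map $X\to\mathbb R^k$ of distortion at most $C\,n\log^2 n$ from $(X,\delta)$ to $(\mathbb R^k,\delta_1)$; 2. for some $k\le C\log n$ there is a map $X\to\mathbb R^k$ of distortion at most $C\,n\log^{3/2} n$ from $(X,\delta)$ to $(\mathbb R^k,\delta_w)$. -/

import Mathlib

open MeasureTheory

/-- `δ`, a function from the finite subsets of `X` to `ℝ`, is a diversity on `X`.  As for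
pseudometrics, sets with more than one element are allowed to have diversity `0`. -/
structure IsDiversity {X : Type*} (δ : Finset X → ℝ) : Prop where
  nonneg : ∀ A : Finset X, 0 ≤ δ A
  eq_zero_of_card_le_one : ∀ A : Finset X, A.card ≤ 1 → δ A = 0
  triangle : ∀ [DecidableEq X] (A B C : Finset X), B.Nonempty →
    δ (A ∪ C) ≤ δ (A ∪ B) + δ (B ∪ C)

open Classical in
/-- The map `φ` from the diversity `(X, δX)` to the diversity `(Y, δY)` has distortion `c`. -/
def HasDistortion {X Y : Type*} (δX : Finset X → ℝ) (δY : Finset Y → ℝ) (φ : X → Y)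
    (c : ℝ) : Prop :=
  1 ≤ c ∧ ∃ c₁ c₂ : ℝ, 0 < c₁ ∧ 0 < c₂ ∧ c = c₁ * c₂ ∧
    ∀ A : Finset X,
      (1 / c₁) * δX A ≤ δY (A.image φ) ∧ δY (A.image φ) ≤ c₂ * δX A

/-- The `ℓ₁` diversity on `ℝᵏ`: the sum over the coordinates `i` of the maximum of
`|a i - b i|` over `a, b ∈ A` (the maximum being `0` if `A` is empty). -/
noncomputable def l1Diversity (k : ℕ) (A : Finset (Fin k → ℝ)) : ℝ :=
  ∑ i : Fin k, (((A ×ˢ A).sup fun p => ‖p.1 i - p.2 i‖₊ : NNReal) : ℝ)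

/-- The width of `K` in the direction `u`: the maximum minus the minimum of `a ⬝ u` over
`a ∈ K`, for a nonempty compact `K`. -/
noncomputable def directionalWidth {k : ℕ} (K : Set (EuclideanSpace ℝ (Fin k)))
    (u : EuclideanSpace ℝ (Fin k)) : ℝ :=
  sSup ((fun a => inner ℝ a u) '' K) - sInf ((fun a => inner ℝ a u) '' K)

/-- The surface measure on the unit sphere `S^(k-1)` of `ℝᵏ`. -/
noncomputable def surfaceMeasure (k : ℕ) :
    Measure (Metric.sphere (0 : EuclideanSpace ℝ (Fin k)) 1) :=
  (volume : Measure (EuclideanSpace ℝ (Fin k))).toSphere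

/-- The absolute mean width of `K ⊆ ℝᵏ`: the integral of the width over the directions
`u ∈ S^(k-1)`, divided by the total surface measure of the sphere `S^k` of `ℝ^(k+1)`. -/
noncomputable def absoluteMeanWidth {k : ℕ} (K : Set (EuclideanSpace ℝ (Fin k))) : ℝ :=
  (1 / (surfaceMeasure (k + 1)).real Set.univ) *
    ∫ u, directionalWidth K (u : EuclideanSpace ℝ (Fin k)) ∂(surfaceMeasure k)

/-- The mean-width diversity on `ℝᵏ`. -/
noncomputable def meanWidthDiversity (k : ℕ) (A : Finset (EuclideanSpace ℝ (Fin k))) : ℝ :=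
  Real.pi * absoluteMeanWidth (convexHull ℝ (A : Set (EuclideanSpace ℝ (Fin k))))

/-- The average of `f` over the sign vectors indexed by `ι`. -/
noncomputable def signAverage {ι : Type*} [Fintype ι] [DecidableEq ι]
    (f : (ι → Bool) → ℝ) : ℝ :=
  (∑ ε, f ε) / 2 ^ Fintype.card ι

/-- The sign attached to a boolean. -/
def boolSign (b : Bool) : ℝ := if b then 1 else -1

/-- The signed sum of the coordinates of `v`. -/
noncomputable def signedSum {ι : Type*} [Fintype ι] (v : ι → ℝ) (ε : ι → Bool) : ℝ :=
  ∑ i, boolSign (ε i) * v i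

lemma signedSum_smul {ι : Type*} [Fintype ι] (c : ℝ) (v : ι → ℝ) (ε : ι → Bool) :
    signedSum (fun i => c * v i) ε = c * signedSum v ε := by
  simp only [signedSum, Finset.mul_sum]
  exact Finset.sum_congr rfl fun i _ => by ring

lemma boolSign_mul_self (b : Bool) : boolSign b * boolSign b = 1 := by
  cases b <;> simp [boolSign]

section SignAverage

variable {ι : Type*} [Fintype ι] [DecidableEq ι]

lemma signAverage_mono {f g : (ι → Bool) → ℝ} (h : ∀ ε, f ε ≤ g ε) :
    signAverage f ≤ signAverage g := by
  unfold signAverage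
  gcongr
  exact h _

lemma signAverage_const (c : ℝ) : signAverage (fun _ : ι → Bool => c) = c := by
  simp [signAverage]

lemma signAverage_add (f g : (ι → Bool) → ℝ) :
    signAverage (fun ε => f ε + g ε) = signAverage f + signAverage g := by
  simp [signAverage, Finset.sum_add_distrib, add_div]

lemma signAverage_const_mul (c : ℝ) (f : (ι → Bool) → ℝ) :
    signAverage (fun ε => c * f ε) = c * signAverage f := by
  simp [signAverage, ← Finset.mul_sum, mul_div_assoc]

lemma signAverage_exp_signedSum (v : ι → ℝ) :
    signAverage (fun ε => Real.exp (signedSum v ε)) = ∏ i, Real.cosh (v i) := by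
  have h := Finset.prod_univ_sum (fun _ : ι => (Finset.univ : Finset Bool))
    (fun i b => Real.exp (boolSign b * v i))
  rw [Fintype.piFinset_univ] at h
  simp only [signAverage, signedSum, Real.exp_sum, ← h]
  rw [← Finset.card_univ, ← Finset.prod_const, ← Finset.prod_div_distrib]
  refine Finset.prod_congr rfl fun i _ => ?_
  simp [boolSign, Real.cosh_eq]

lemma signAverage_exp_signedSum_le (v : ι → ℝ) :
    signAverage (fun ε => Real.exp (signedSum v ε)) ≤ Real.exp ((∑ i, v i ^ 2) / 2) := by
  rw [signAverage_exp_signedSum, Finset.sum_div, Real.exp_sum]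
  exact Finset.prod_le_prod (fun i _ => (Real.cosh_pos _).le)
    fun i _ => Real.cosh_le_exp_half_sq _

lemma sum_boolSign_mul_boolSign {i j : ι} (hij : i ≠ j) :
    ∑ ε : ι → Bool, boolSign (ε i) * boolSign (ε j) = 0 := by
  refine Finset.sum_involution (fun ε _ => Function.update ε i (!ε i)) ?_ ?_ ?_ ?_
  · intro ε _
    rw [Function.update_self, Function.update_of_ne hij.symm]
    cases ε i <;> cases ε j <;> simp [boolSign]
  · intro ε _ _ h
    have := congrFun h i
    rw [Function.update_self] at this
    cases h' : ε i <;> simp [h'] at this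
  · simp
  · intro ε _
    simp

lemma signAverage_signedSum_sq (v : ι → ℝ) :
    signAverage (fun ε => signedSum v ε ^ 2) = ∑ i, v i ^ 2 := by
  have h1 : ∀ ε : ι → Bool, signedSum v ε ^ 2 =
      ∑ i, ∑ j, v i * v j * (boolSign (ε i) * boolSign (ε j)) := by
    intro ε
    rw [sq, signedSum, Finset.sum_mul_sum]
    exact Finset.sum_congr rfl fun i _ => Finset.sum_congr rfl fun j _ => by ring
  simp only [signAverage, h1]
  rw [Finset.sum_comm, Finset.sum_div]
  refine Finset.sum_congr rfl fun i _ => ?_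
  rw [Finset.sum_comm, Finset.sum_eq_single i]
  · simp only [boolSign_mul_self]
    simp
    ring
  · intro j _ hj
    rw [← Finset.mul_sum, sum_boolSign_mul_boolSign hj.symm, mul_zero]
  · simp

lemma pow_four_le_exp_add_exp_neg (y : ℝ) : y ^ 4 ≤ 24 * (Real.exp y + Real.exp (-y)) := by
  have key : ∀ z : ℝ, 0 ≤ z → z ^ 4 ≤ 24 * (Real.exp z + Real.exp (-z)) := by
    intro z hz
    have h := Real.pow_div_factorial_le_exp z hz 4
    have h' := Real.exp_pos (-z)
    norm_num [Nat.factorial] at h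
    linarith
  rcases le_total 0 y with hy | hy
  · exact key y hy
  · have := key (-y) (by linarith)
    rw [neg_neg] at this
    rw [show y ^ 4 = (-y) ^ 4 by ring]
    linarith

lemma signAverage_signedSum_pow_four_le {v : ι → ℝ} (hv : ∑ i, v i ^ 2 = 1) :
    signAverage (fun ε => signedSum v ε ^ 4) ≤ 80 := by
  have h1 := signAverage_exp_signedSum_le v
  have h2 := signAverage_exp_signedSum_le (fun i => (-1) * v i)
  simp only [signedSum_smul, mul_pow] at h2
  norm_num [hv] at h1 h2
  have h3 : Real.exp (1 / 2) ≤ 5 / 3 := by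
    have h := Real.exp_bound_div_one_sub_of_interval (x := 1 / 2) (by norm_num) (by norm_num)
    have h4 : Real.exp (1 / 2) * Real.exp (1 / 2) = Real.exp 1 := by
      rw [← Real.exp_add]; norm_num
    nlinarith [Real.exp_one_lt_d9, Real.exp_pos (1 / 2)]
  calc _ ≤ signAverage (fun ε => 24 * (Real.exp (signedSum v ε) + Real.exp (-signedSum v ε))) :=
        signAverage_mono fun ε => pow_four_le_exp_add_exp_neg _
    _ ≤ 80 := by
      rw [signAverage_const_mul, signAverage_add]
      linarith

/-- Khintchine's inequality between the first and the second moment. -/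
lemma khintchine_unit {v : ι → ℝ} (hv : ∑ i, v i ^ 2 = 1) :
    1 / 50 ≤ signAverage (fun ε => |signedSum v ε|) := by
  have h2 := signAverage_signedSum_sq v
  have h4 := signAverage_signedSum_pow_four_le hv
  have key : ∀ y : ℝ, y ^ 2 + -(1 / 160) * y ^ 4 ≤ 13 * |y| := by
    intro y
    rw [← sq_abs, show y ^ 4 = |y| ^ 4 by rw [pow_abs, abs_of_nonneg (by positivity)]]
    have hy := abs_nonneg y
    set z := |y|
    rcases le_total z 13 with h | h
    · nlinarith [pow_nonneg hy 4]
    · nlinarith [mul_nonneg (sq_nonneg z) (by nlinarith : 0 ≤ z ^ 2 - 160)]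
  have h := signAverage_mono (fun ε => key (signedSum v ε))
  rw [signAverage_add, signAverage_const_mul, signAverage_const_mul] at h
  rw [hv] at h2
  linarith

lemma signAverage_exp_neg_sq_le {v : ι → ℝ} (hv : ∑ i, v i ^ 2 = 1) :
    signAverage (fun ε => Real.exp (-(signedSum v ε ^ 2 / 80))) ≤ Real.exp (-(1 / 160)) := by
  have h2 := signAverage_signedSum_sq v
  have h4 := signAverage_signedSum_pow_four_le hv
  rw [hv] at h2
  have key : ∀ y : ℝ, Real.exp (-(y ^ 2 / 80)) ≤
      1 + (-(1 / 80) * y ^ 2 + 1 / 12800 * y ^ 4) := by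
    intro y
    have h := Real.quadratic_le_exp_of_nonneg (x := y ^ 2 / 80) (by positivity)
    have h0 : (0 : ℝ) ≤ y ^ 2 / 80 := by positivity
    rw [Real.exp_neg, inv_le_iff_one_le_mul₀ (Real.exp_pos _)]
    set x := y ^ 2 / 80 with hx
    have e : 1 + (-(1 / 80) * y ^ 2 + 1 / 12800 * y ^ 4) = 1 - x + x ^ 2 / 2 := by
      rw [hx]; ring
    rw [e]
    have : 0 ≤ 1 - x + x ^ 2 / 2 := by nlinarith [sq_nonneg (x - 1)]
    nlinarith [mul_le_mul_of_nonneg_left h this, pow_nonneg h0 4]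
  refine (signAverage_mono fun ε => key (signedSum v ε)).trans ?_
  rw [signAverage_add, signAverage_add, signAverage_const_mul, signAverage_const_mul,
    signAverage_const, h2]
  have := Real.add_one_le_exp (-(1 / 160) : ℝ)
  linarith

lemma integral_exp_linear_sub_sq (y : ℝ) :
    Integrable (fun x : ℝ => Real.exp (y * x) * Real.exp (-(x ^ 2))) ∧
    ∫ x : ℝ, Real.exp (y * x) * Real.exp (-(x ^ 2)) =
      √Real.pi * Real.exp (y ^ 2 / 4) := by
  have e : (fun x : ℝ => Real.exp (y * x) * Real.exp (-(x ^ 2))) =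
      fun x => Real.exp (y ^ 2 / 4) * Real.exp (-1 * (x - y / 2) ^ 2) := by
    funext x
    rw [← Real.exp_add, ← Real.exp_add]
    ring_nf
  rw [e]
  constructor
  · exact ((integrable_exp_neg_mul_sq one_pos).comp_sub_right (y / 2)).const_mul _
  · rw [integral_const_mul, integral_sub_right_eq_self (fun x : ℝ => Real.exp (-1 * x ^ 2)),
      integral_gaussian]
    simp [mul_comm]

lemma signAverage_exp_sq_le {v : ι → ℝ} (hv : ∑ i, v i ^ 2 = 1) :
    signAverage (fun ε => Real.exp (signedSum v ε ^ 2 / 4)) ≤ Real.exp 1 := by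
  have hpi : 0 < √Real.pi := Real.sqrt_pos.2 Real.pi_pos
  have hb : (0 : ℝ) < 1 / 2 := by norm_num
  have h1 : √Real.pi * signAverage (fun ε => Real.exp (signedSum v ε ^ 2 / 4)) =
      ∫ x : ℝ, signAverage (fun ε => Real.exp (signedSum (fun i => x * v i) ε)) *
        Real.exp (-(x ^ 2)) := by
    simp only [signAverage, signedSum_smul, div_mul_eq_mul_div, Finset.sum_mul]
    rw [integral_div, integral_finsetSum]
    · rw [← mul_div_assoc, Finset.mul_sum]
      congr 1
      refine Finset.sum_congr rfl fun ε _ => ?_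
      simp only [mul_comm _ (signedSum v ε)]
      exact (integral_exp_linear_sub_sq _).2.symm
    · intro ε _
      simp only [mul_comm _ (signedSum v ε)]
      exact (integral_exp_linear_sub_sq _).1
  have h2 : ∫ x : ℝ, signAverage (fun ε => Real.exp (signedSum (fun i => x * v i) ε)) *
        Real.exp (-(x ^ 2)) ≤ ∫ x : ℝ, Real.exp (-(1 / 2) * x ^ 2) := by
    refine integral_mono_of_nonneg (Filter.Eventually.of_forall fun x => ?_)
      (integrable_exp_neg_mul_sq hb) (Filter.Eventually.of_forall fun x => ?_)
    · refine mul_nonneg ?_ (Real.exp_pos _).le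
      rw [signAverage_exp_signedSum]
      exact Finset.prod_nonneg fun i _ => (Real.cosh_pos _).le
    · have := signAverage_exp_signedSum_le (fun i => x * v i)
      simp only [mul_pow, ← Finset.mul_sum, hv] at this
      refine (mul_le_mul_of_nonneg_right this (Real.exp_pos _).le).trans ?_
      rw [← Real.exp_add]
      ring_nf
      exact le_rfl
  rw [integral_gaussian, ← h1] at h2
  have h3 : √(Real.pi / (1 / 2)) ≤ √Real.pi * 2 := by
    rw [show (2 : ℝ) = √4 by rw [show (4 : ℝ) = 2 ^ 2 by norm_num]; simp,
      ← Real.sqrt_mul Real.pi_pos.le]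
    apply Real.sqrt_le_sqrt
    nlinarith [Real.pi_pos, Real.sq_sqrt (show (0 : ℝ) ≤ 4 by norm_num), Real.sqrt_nonneg 4]
  have h4 := le_of_mul_le_mul_left (h2.trans h3) hpi
  linarith [Real.add_one_le_exp (1 : ℝ)]

end SignAverage

section JohnsonLindenstrauss

variable {ι : Type*} [Fintype ι] [DecidableEq ι]

lemma sum_exp_sum_le_of_signAverage_le {g : (ι → Bool) → ℝ} {a : ℝ}
    (h : signAverage (fun ε => Real.exp (g ε)) ≤ Real.exp a) (k : ℕ) :
    ∑ E : Fin k → ι → Bool, Real.exp (∑ s, g (E s)) ≤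
      Real.exp (k * a) * ((2 : ℝ) ^ Fintype.card ι) ^ k := by
  simp only [Real.exp_sum]
  rw [← Fintype.sum_pow (fun ε => Real.exp (g ε)) k, Real.exp_nat_mul, ← mul_pow]
  refine pow_le_pow_left₀ (Finset.sum_nonneg fun ε _ => (Real.exp_pos _).le) ?_ k
  rwa [signAverage, div_le_iff₀ (by positivity)] at h

/-- Random signs reduce the dimension while preserving Euclidean lengths up to a constant. -/
lemma exists_signs_sum_sq_bounds {P : Type*} [Fintype P] (v : P → ι → ℝ) (k : ℕ)
    (hk : 2 * (Fintype.card P : ℝ) * Real.exp (-(k / 320)) < 1) :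
    ∃ E : Fin k → ι → Bool, ∀ p,
      k / 4 * ∑ i, v p i ^ 2 ≤ ∑ s, signedSum (v p) (E s) ^ 2 ∧
      ∑ s, signedSum (v p) (E s) ^ 2 ≤ 8 * k * ∑ i, v p i ^ 2 := by
  classical
  set r : P → ℝ := fun p => √(∑ i, v p i ^ 2) with hr
  have hr2 : ∀ p, r p ^ 2 = ∑ i, v p i ^ 2 := fun p =>
    Real.sq_sqrt (Finset.sum_nonneg fun i _ => sq_nonneg _)
  set u : P → ι → ℝ := fun p i => (r p)⁻¹ * v p i with hu
  have hu1 : ∀ p, r p ≠ 0 → ∑ i, u p i ^ 2 = 1 := by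
    intro p hp
    simp only [hu, mul_pow, ← Finset.mul_sum, ← hr2]
    field_simp
  set Q : Finset P := Finset.univ.filter fun p => r p ≠ 0 with hQ
  set N : ℝ := ((2 : ℝ) ^ Fintype.card ι) ^ k with hN
  have hNpos : 0 < N := by positivity
  set Φ : (Fin k → ι → Bool) → P → ℝ := fun E p =>
    Real.exp (∑ s, signedSum (u p) (E s) ^ 2 / 4) * Real.exp (-(2 * k)) +
      Real.exp (∑ s, -(signedSum (u p) (E s) ^ 2 / 80)) * Real.exp (k / 320) with hΦ
  have hsum : ∑ E, ∑ p ∈ Q, Φ E p < ∑ E : Fin k → ι → Bool, (1 : ℝ) := by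
    have hcard : ∑ E : Fin k → ι → Bool, (1 : ℝ) = N := by
      simp [hN]
    rw [hcard, Finset.sum_comm]
    have hp : ∀ p ∈ Q, ∑ E, Φ E p ≤ 2 * Real.exp (-(k / 320)) * N := by
      intro p hp
      have hp' := hu1 p (Finset.mem_filter.1 hp).2
      simp only [hΦ]
      rw [Finset.sum_add_distrib, ← Finset.sum_mul, ← Finset.sum_mul]
      have h1 := sum_exp_sum_le_of_signAverage_le (signAverage_exp_sq_le hp') k
      have h2 := sum_exp_sum_le_of_signAverage_le (signAverage_exp_neg_sq_le hp') k
      have h1' := mul_le_mul_of_nonneg_right h1 (Real.exp_pos (-(2 * k : ℝ))).le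
      have h2' := mul_le_mul_of_nonneg_right h2 (Real.exp_pos (k / 320 : ℝ)).le
      rw [mul_right_comm, ← Real.exp_add] at h1' h2'
      have e1 : Real.exp (k * 1 + -(2 * k)) ≤ Real.exp (-(k / 320)) := by
        apply Real.exp_le_exp.2
        have : (0 : ℝ) ≤ k := by positivity
        linarith
      have e2 : Real.exp (k * -(1 / 160) + k / 320) = Real.exp (-(k / 320)) := by
        congr 1; ring
      rw [e2] at h2'
      nlinarith [mul_le_mul_of_nonneg_right e1 hNpos.le]
    calc ∑ p ∈ Q, ∑ E, Φ E p ≤ ∑ p ∈ Q, 2 * Real.exp (-(k / 320)) * N :=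
          Finset.sum_le_sum hp
      _ ≤ ∑ _p : P, 2 * Real.exp (-(k / 320)) * N :=
          Finset.sum_le_sum_of_subset_of_nonneg (Finset.subset_univ _)
            fun _ _ _ => by positivity
      _ = (2 * (Fintype.card P : ℝ) * Real.exp (-(k / 320))) * N := by
          simp; ring
      _ < 1 * N := by gcongr
      _ = N := one_mul N
  obtain ⟨E, -, hE⟩ := Finset.exists_lt_of_sum_lt hsum
  refine ⟨E, fun p => ?_⟩
  have hvu : ∀ s, r p ≠ 0 → signedSum (v p) (E s) ^ 2 =
      (∑ i, v p i ^ 2) * signedSum (u p) (E s) ^ 2 := by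
    intro s hp
    rw [← hr2, ← mul_pow, ← signedSum_smul]
    congr 2
    funext i
    simp only [hu]
    field_simp
  by_cases hp : r p = 0
  · have h0 : ∑ i, v p i ^ 2 = 0 := by rw [← hr2, hp]; simp
    have hv : ∀ i, v p i = 0 := fun i => by
      have := (Finset.sum_eq_zero_iff_of_nonneg (fun i _ => sq_nonneg (v p i))).1 h0 i
        (Finset.mem_univ i)
      simpa using this
    simp [signedSum, hv]
  · have hpQ : p ∈ Q := by simp [hQ, hp]
    have hpos : 0 ≤ ∑ i, v p i ^ 2 := Finset.sum_nonneg fun i _ => sq_nonneg _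
    have hlt : Φ E p < 1 :=
      (Finset.single_le_sum (f := Φ E) (fun q _ => by positivity) hpQ).trans_lt hE
    simp only [hΦ, ← Real.exp_add] at hlt
    have h1 : Real.exp (∑ s, signedSum (u p) (E s) ^ 2 / 4 + -(2 * k)) < 1 := by
      linarith [Real.exp_pos (∑ s, -(signedSum (u p) (E s) ^ 2 / 80) + (k / 320 : ℝ))]
    have h2 : Real.exp (∑ s, -(signedSum (u p) (E s) ^ 2 / 80) + k / 320) < 1 := by
      linarith [Real.exp_pos (∑ s, signedSum (u p) (E s) ^ 2 / 4 + -(2 * k : ℝ))]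
    rw [Real.exp_lt_one_iff] at h1 h2
    rw [Finset.sum_neg_distrib, ← Finset.sum_div] at h2
    rw [← Finset.sum_div] at h1
    simp only [fun s => hvu s hp, ← Finset.mul_sum]
    constructor <;> nlinarith

end JohnsonLindenstrauss

section Bourgain

variable {X : Type*} [Fintype X] [DecidableEq X]

/-- The probability of `S` if every point is chosen independently with probability `p`. -/
noncomputable def bernoulliWeight (p : ℝ) (S : Finset X) : ℝ :=
  p ^ S.card * (1 - p) ^ Sᶜ.card

lemma sum_bernoulliWeight_disjoint (p : ℝ) (U : Finset X) :
    ∑ S, (if Disjoint S U then bernoulliWeight p S else 0) = (1 - p) ^ U.card := by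
  have h := Finset.prod_add (fun i => if i ∈ U then 0 else p) (fun _ => 1 - p)
    (Finset.univ : Finset X)
  have h1 : ∀ i, (if i ∈ U then 0 else p) + (1 - p) = if i ∈ U then 1 - p else 1 := by
    intro i; split_ifs <;> ring
  simp only [h1, Finset.prod_ite_mem, Finset.univ_inter, Finset.prod_const,
    Finset.powerset_univ] at h
  rw [h]
  refine Finset.sum_congr rfl fun S _ => ?_
  rw [← Finset.compl_eq_univ_sdiff, bernoulliWeight]
  split_ifs with hd
  · rw [Finset.prod_congr rfl (fun i hi => if_neg (Finset.disjoint_left.1 hd hi))]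
    simp
  · obtain ⟨i, hiS, hiU⟩ := Finset.not_disjoint_iff.1 hd
    rw [Finset.prod_eq_zero hiS (by rw [if_pos hiU]), zero_mul]

lemma sum_bernoulliWeight (p : ℝ) : ∑ S : Finset X, bernoulliWeight p S = 1 := by
  have := sum_bernoulliWeight_disjoint p (∅ : Finset X)
  simpa using this

lemma bernoulliWeight_nonneg {p : ℝ} (h0 : 0 ≤ p) (h1 : p ≤ 1) (S : Finset X) :
    0 ≤ bernoulliWeight p S :=
  mul_nonneg (pow_nonneg h0 _) (pow_nonneg (by linarith) _)

lemma sum_bernoulliWeight_separate (p : ℝ) {U V : Finset X} (h : Disjoint U V) :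
    ∑ S, (if Disjoint S U ∧ ¬ Disjoint S V then bernoulliWeight p S else 0) =
      (1 - p) ^ U.card * (1 - (1 - p) ^ V.card) := by
  have h1 := sum_bernoulliWeight_disjoint p U
  have h2 := sum_bernoulliWeight_disjoint p (U ∪ V)
  rw [Finset.card_union_of_disjoint h, pow_add] at h2
  rw [mul_sub, mul_one, ← h2, ← h1, ← Finset.sum_sub_distrib]
  refine Finset.sum_congr rfl fun S _ => ?_
  by_cases a : Disjoint S U <;> by_cases b : Disjoint S V <;>
    simp [Finset.disjoint_union_right, a, b]

lemma separation_probability {i m m' : ℕ} (h1 : 2 ^ i ≤ m) (h2 : m < 2 ^ (i + 1))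
    (h3 : m ≤ m') :
    (1 : ℝ) / 12 ≤ (1 - 1 / 2 ^ (i + 1)) ^ m * (1 - (1 - 1 / 2 ^ (i + 1)) ^ m') := by
  set p : ℝ := 1 / 2 ^ (i + 1) with hp
  have hp0 : 0 < p := by positivity
  have hpi : (2 : ℝ) ^ i * p = 1 / 2 := by rw [hp, pow_succ]; field_simp
  have h2i : (1 : ℝ) ≤ 2 ^ i := one_le_pow₀ (by norm_num)
  have hp1 : p ≤ 1 / 2 := by nlinarith
  have hA : (1 : ℝ) / 4 ≤ (1 - p) ^ m := by
    have hb : (1 : ℝ) / 2 ≤ (1 - p) ^ (2 ^ i) := by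
      have := one_add_mul_le_pow (a := -p) (by linarith) (2 ^ i)
      push_cast at this
      rw [← sub_eq_add_neg] at this
      linarith
    calc (1 : ℝ) / 4 ≤ ((1 - p) ^ (2 ^ i)) ^ 2 := by nlinarith
      _ = (1 - p) ^ (2 ^ (i + 1)) := by rw [← pow_mul, pow_succ]
      _ ≤ (1 - p) ^ m := pow_le_pow_of_le_one (by linarith) (by linarith) h2.le
  have hB : (1 - p) ^ m' ≤ 2 / 3 := by
    have hb : (3 : ℝ) / 2 ≤ (1 + p) ^ (2 ^ i) := by
      have := one_add_mul_le_pow (a := p) (by linarith) (2 ^ i)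
      push_cast at this
      linarith
    have hc : (1 - p) ^ (2 ^ i) * (1 + p) ^ (2 ^ i) ≤ 1 := by
      rw [← mul_pow]
      exact pow_le_one₀ (by nlinarith) (by nlinarith)
    have hd : 0 ≤ (1 - p) ^ (2 ^ i) := pow_nonneg (by linarith) _
    have : (1 - p) ^ m' ≤ (1 - p) ^ (2 ^ i) :=
      pow_le_pow_of_le_one (by linarith) (by linarith) (h1.trans h3)
    nlinarith
  nlinarith

/-- The total weight of `S` in the superposition of the random sets of density `2 ^ -(i + 1)`
with `i < L`. -/
noncomputable def scaleWeight (L : ℕ) (S : Finset X) : ℝ :=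
  ∑ i ∈ Finset.range L, bernoulliWeight (1 / 2 ^ (i + 1)) S

lemma inv_two_pow_mem (i : ℕ) : 0 ≤ (1 : ℝ) / 2 ^ (i + 1) ∧ (1 : ℝ) / 2 ^ (i + 1) ≤ 1 := by
  refine ⟨by positivity, ?_⟩
  rw [div_le_one (by positivity)]
  exact one_le_pow₀ (by norm_num)

lemma scaleWeight_nonneg (L : ℕ) (S : Finset X) : 0 ≤ scaleWeight L S :=
  Finset.sum_nonneg fun i _ =>
    bernoulliWeight_nonneg (inv_two_pow_mem i).1 (inv_two_pow_mem i).2 S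

lemma sum_scaleWeight (L : ℕ) : ∑ S : Finset X, scaleWeight L S = L := by
  unfold scaleWeight
  rw [Finset.sum_comm]
  simp [sum_bernoulliWeight]

lemma sum_scaleWeight_separate {U V : Finset X} (h : Disjoint U V) (hU : U.Nonempty)
    (hV : V.Nonempty) :
    1 / 12 ≤ ∑ S, (if (Disjoint S U ↔ Disjoint S V) then 0
      else scaleWeight (Nat.log 2 (Fintype.card X) + 1) S) := by
  wlog hc : U.card ≤ V.card generalizing U V
  · have := this h.symm hV hU (le_of_not_ge hc)
    simpa only [iff_comm] using this
  have hi : Nat.log 2 U.card ∈ Finset.range (Nat.log 2 (Fintype.card X) + 1) := by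
    rw [Finset.mem_range, Nat.lt_succ_iff]
    exact Nat.log_mono_right (Finset.card_le_univ U)
  set i := Nat.log 2 U.card
  refine (separation_probability (Nat.pow_log_le_self 2 (Finset.card_pos.2 hU).ne')
    (Nat.lt_pow_succ_log_self (by norm_num) _) hc).trans ?_
  rw [← sum_bernoulliWeight_separate _ h]
  refine Finset.sum_le_sum fun S _ => ?_
  have hle : bernoulliWeight (1 / 2 ^ (i + 1)) S ≤
      scaleWeight (Nat.log 2 (Fintype.card X) + 1) S :=
    Finset.single_le_sum (f := fun i => bernoulliWeight ((1 : ℝ) / 2 ^ (i + 1)) S)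
      (fun i _ => bernoulliWeight_nonneg (inv_two_pow_mem i).1 (inv_two_pow_mem i).2 S) hi
  have h0 := scaleWeight_nonneg (Nat.log 2 (Fintype.card X) + 1) S
  by_cases a : Disjoint S U <;> by_cases b : Disjoint S V <;> simp [a, b, h0]
  all_goals simpa using hle

end Bourgain

lemma abs_infDist_sub_le {X : Type*} [PseudoMetricSpace X] (S : Set X) (x y : X) :
    |Metric.infDist x S - Metric.infDist y S| ≤ dist x y := by
  rw [abs_sub_le_iff]
  have h1 := Metric.infDist_le_infDist_add_dist (s := S) (x := x) (y := y)
  have h2 := Metric.infDist_le_infDist_add_dist (s := S) (x := y) (y := x)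
  rw [dist_comm] at h2
  constructor <;> linarith

section MetricEmbedding

variable {X : Type*} [PseudoMetricSpace X] [Fintype X]

lemma infDist_le_iff_not_disjoint {S : Finset X} (hS : S.Nonempty) (x : X) (r : ℝ) :
    Metric.infDist x S ≤ r ↔ ¬ Disjoint S (Finset.univ.filter fun z => dist x z ≤ r) := by
  rw [Finset.not_disjoint_iff]
  constructor
  · intro h
    obtain ⟨z, hz, he⟩ := S.finite_toSet.isCompact.exists_infDist_eq_dist (by simpa using hS) x
    exact ⟨z, hz, by simpa [← he] using h⟩
  · rintro ⟨z, hz, h⟩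
    simp only [Finset.mem_filter, Finset.mem_univ, true_and] at h
    exact (Metric.infDist_le_dist_of_mem (s := (S : Set X)) hz).trans h

variable [DecidableEq X]

lemma dist_le_sum_scaleWeight_mul_abs (x y : X) :
    dist x y / 24 ≤ ∑ S : Finset X, scaleWeight (Nat.log 2 (Fintype.card X) + 1) S *
      |Metric.infDist x S - Metric.infDist y S| := by
  set w : Finset X → ℝ := scaleWeight (Nat.log 2 (Fintype.card X) + 1) with hw
  set D := dist x y with hD
  have hD0 : 0 ≤ D := dist_nonneg
  set I : Finset X → Set ℝ := fun S =>
    Set.Ico (min (Metric.infDist x S) (Metric.infDist y S))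
      (max (Metric.infDist x S) (Metric.infDist y S)) with hI
  have hpt : ∀ r ∈ Set.Ico 0 (D / 2),
      (1 : ℝ) / 12 ≤ ∑ S, w S * (I S).indicator (fun _ => 1) r := by
    intro r hr
    have hxU : x ∈ Finset.univ.filter fun z => dist x z ≤ r := by simp [hr.1]
    have hyV : y ∈ Finset.univ.filter fun z => dist y z ≤ r := by simp [hr.1]
    have hdisj : Disjoint (Finset.univ.filter fun z => dist x z ≤ r)
        (Finset.univ.filter fun z => dist y z ≤ r) := by
      rw [Finset.disjoint_left]
      intro z h1 h2
      simp only [Finset.mem_filter, Finset.mem_univ, true_and] at h1 h2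
      have := dist_triangle_right x y z
      linarith [hr.2]
    refine (sum_scaleWeight_separate hdisj ⟨x, hxU⟩ ⟨y, hyV⟩).trans
      (Finset.sum_le_sum fun S _ => ?_)
    have hw0 : 0 ≤ w S := scaleWeight_nonneg _ S
    split_ifs with h
    · exact mul_nonneg hw0 (Set.indicator_nonneg (fun _ _ => zero_le_one) r)
    · have hS : S.Nonempty := by
        rw [Finset.nonempty_iff_ne_empty]
        rintro rfl
        simp at h
      have hx := infDist_le_iff_not_disjoint hS x r
      have hy := infDist_le_iff_not_disjoint hS y r
      have hmem : r ∈ I S := by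
        simp only [hI, Set.mem_Ico, min_le_iff, max_le_iff, ← not_le, hx, hy]
        tauto
      rw [Set.indicator_of_mem hmem, mul_one]
  have hmeas : ∀ S, MeasurableSet (I S) := fun S => measurableSet_Ico
  have hint : ∀ S ∈ (Finset.univ : Finset (Finset X)),
      Integrable (fun r => w S * (I S).indicator (fun _ => (1 : ℝ)) r)
        (volume.restrict (Set.Ico 0 (D / 2))) := fun S _ =>
    ((integrable_const (1 : ℝ)).indicator (hmeas S)).const_mul _
  have h1 : ∫ r in Set.Ico 0 (D / 2), (1 : ℝ) / 12 ≤
      ∫ r in Set.Ico 0 (D / 2), ∑ S, w S * (I S).indicator (fun _ => 1) r :=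
    setIntegral_mono_on (integrable_const _) (integrable_finsetSum _ hint)
      measurableSet_Ico hpt
  rw [integral_finsetSum _ hint, setIntegral_const] at h1
  have h2 : ∀ S, ∫ r in Set.Ico 0 (D / 2), w S * (I S).indicator (fun _ => (1 : ℝ)) r ≤
      w S * |Metric.infDist x S - Metric.infDist y S| := by
    intro S
    rw [integral_const_mul]
    refine mul_le_mul_of_nonneg_left ?_ (scaleWeight_nonneg _ S)
    rw [integral_indicator_const _ (hmeas S), smul_eq_mul, mul_one,
      measureReal_restrict_apply (hmeas S)]
    refine (measureReal_mono Set.inter_subset_left (by simp [hI])).trans ?_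
    rw [hI, Real.volume_real_Ico_of_le (min_le_max), max_sub_min_eq_abs']
  have h3 := h1.trans (Finset.sum_le_sum fun S _ => h2 S)
  rw [Real.volume_real_Ico_of_le (by linarith), smul_eq_mul] at h3
  linarith

lemma signedSum_sub {ι : Type*} [Fintype ι] (v w : ι → ℝ) (ε : ι → Bool) :
    signedSum (fun i => v i - w i) ε = signedSum v ε - signedSum w ε := by
  simp [signedSum, mul_sub, Finset.sum_sub_distrib]

lemma card_log_bounds {n : ℕ} (hn : 2 ≤ n) :
    2 / 3 ≤ Real.log n ∧ ((Nat.log 2 n + 1 : ℕ) : ℝ) ≤ 3 * Real.log n := by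
  have hlog2 := Real.log_two_gt_d9
  have h1 : Real.log 2 ≤ Real.log n := Real.log_le_log (by norm_num) (by exact_mod_cast hn)
  have h2 : (Nat.log 2 n : ℝ) * Real.log 2 ≤ Real.log n := by
    rw [← Real.log_pow]
    refine Real.log_le_log (by positivity) ?_
    exact_mod_cast Nat.pow_log_le_self 2 (by omega)
  refine ⟨by linarith, ?_⟩
  push_cast
  nlinarith [(Nat.log 2 n).cast_nonneg (α := ℝ)]

/-- A finite metric space of size `n` embeds with distortion `O(log n)` into a Euclidean space of
dimension `O(log n)`. -/
theorem exists_euclidean_embedding (hn : 2 ≤ Fintype.card X) :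
    ∃ (k : ℕ) (f : X → EuclideanSpace ℝ (Fin k)) (α : ℝ), 0 < k ∧
      (k : ℝ) ≤ 963 * Real.log (Fintype.card X) ∧ 0 < α ∧
      ∀ x y, α * dist x y ≤ dist (f x) (f y) ∧
        dist (f x) (f y) ≤ 432 * Real.log (Fintype.card X) * α * dist x y := by
  set n := Fintype.card X with hn'
  obtain ⟨hlog, hL⟩ := card_log_bounds hn
  set L := Nat.log 2 n + 1 with hLdef
  have hL0 : (0 : ℝ) < L := by rw [hLdef]; positivity
  set k := ⌈960 * Real.log n⌉₊ + 1 with hk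
  have hk0 : (0 : ℝ) < k := by rw [hk]; positivity
  have hk1 : 960 * Real.log n < k := by
    rw [hk]; push_cast; linarith [Nat.le_ceil (960 * Real.log n)]
  have hk2 : (k : ℝ) ≤ 963 * Real.log n := by
    rw [hk]; push_cast; linarith [Nat.ceil_lt_add_one (show 0 ≤ 960 * Real.log n by linarith)]
  have hn2 : (2 : ℝ) ≤ n := by exact_mod_cast hn
  have hprob : 2 * (Fintype.card (X × X) : ℝ) * Real.exp (-(k / 320)) < 1 := by
    have h1 : Real.exp (-(k / 320)) < Real.exp (-(3 * Real.log n)) :=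
      Real.exp_lt_exp.2 (by linarith)
    have h2 : Real.exp (-(3 * Real.log n)) = ((n : ℝ) ^ 3)⁻¹ := by
      rw [Real.exp_neg, ← Real.exp_log (show (0 : ℝ) < n ^ 3 by positivity), Real.log_pow]
      norm_num
    rw [h2] at h1
    rw [Fintype.card_prod, ← hn']
    push_cast
    calc 2 * ((n : ℝ) * n) * Real.exp (-(k / 320)) < 2 * ((n : ℝ) * n) * ((n : ℝ) ^ 3)⁻¹ := by
          gcongr
      _ ≤ n * ((n : ℝ) * n) * ((n : ℝ) ^ 3)⁻¹ := by gcongr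
      _ = 1 := by field_simp
  set g : X → Finset X → ℝ := fun x S => √(scaleWeight L S) * Metric.infDist x (S : Set X) with hg
  obtain ⟨E, hE⟩ := exists_signs_sum_sq_bounds
    (fun (p : X × X) S => g p.1 S - g p.2 S) k hprob
  refine ⟨k, fun x => WithLp.toLp 2 fun s => signedSum (g x) (E s), √k / (48 * √L),
    by omega, hk2, by positivity, fun x y => ?_⟩
  obtain ⟨hE1, hE2⟩ := hE (x, y)
  simp only [signedSum_sub] at hE1 hE2
  have hv : ∀ S, (g x S - g y S) ^ 2 =
      scaleWeight L S * |Metric.infDist x (S : Set X) - Metric.infDist y (S : Set X)| ^ 2 := by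
    intro S
    rw [hg, ← mul_sub, mul_pow, Real.sq_sqrt (scaleWeight_nonneg L S), sq_abs]
  simp only [hv] at hE1 hE2
  have hup : ∑ S : Finset X, scaleWeight L S * |Metric.infDist x (S : Set X) - Metric.infDist y (S : Set X)| ^ 2 ≤
      L * dist x y ^ 2 := by
    rw [← sum_scaleWeight (X := X) L, Finset.sum_mul]
    gcongr with S _
    · exact scaleWeight_nonneg L S
    · exact abs_infDist_sub_le _ x y
  have hlow : (dist x y / 24) ^ 2 ≤
      L * ∑ S : Finset X, scaleWeight L S * |Metric.infDist x (S : Set X) - Metric.infDist y (S : Set X)| ^ 2 := by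
    have h1 := dist_le_sum_scaleWeight_mul_abs x y
    have h2 := Finset.sum_sq_le_sum_mul_sum_of_sq_le_mul (Finset.univ : Finset (Finset X))
      (f := fun S => scaleWeight L S)
      (g := fun S => scaleWeight L S * |Metric.infDist x (S : Set X) - Metric.infDist y (S : Set X)| ^ 2)
      (r := fun S => scaleWeight L S * |Metric.infDist x (S : Set X) - Metric.infDist y (S : Set X)|)
      (fun S _ => scaleWeight_nonneg L S)
      (fun S _ => mul_nonneg (scaleWeight_nonneg L S) (sq_nonneg _)) (fun S _ => by apply le_of_eq; ring)
    rw [sum_scaleWeight] at h2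
    exact (pow_le_pow_left₀ (by positivity) h1 2).trans h2
  rw [EuclideanSpace.dist_eq]
  simp only [Real.dist_eq, sq_abs]
  have hd : 0 ≤ dist x y := dist_nonneg
  constructor
  · apply Real.le_sqrt_of_sq_le
    refine le_trans ?_ hE1
    rw [mul_pow, div_pow, mul_pow, Real.sq_sqrt hk0.le, Real.sq_sqrt hL0.le,
      div_mul_eq_mul_div, div_le_iff₀ (by positivity)]
    nlinarith [mul_le_mul_of_nonneg_left hlow hk0.le]
  · refine (Real.sqrt_le_sqrt (hE2.trans (mul_le_mul_of_nonneg_left hup (by positivity)))).trans ?_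
    have e : 8 * (k : ℝ) * (L * dist x y ^ 2) ≤ (3 * √k * √L * dist x y) ^ 2 := by
      simp only [mul_pow, Real.sq_sqrt hk0.le, Real.sq_sqrt hL0.le]
      nlinarith [mul_nonneg (mul_nonneg hk0.le hL0.le) (sq_nonneg (dist x y))]
    refine (Real.sqrt_le_left (by positivity)).2 e |>.trans ?_
    refine mul_le_mul_of_nonneg_right ?_ hd
    have hs : √(L : ℝ) * √L = L := Real.mul_self_sqrt hL0.le
    rw [mul_div_assoc', le_div_iff₀ (by positivity)]
    calc 3 * √k * √L * (48 * √L) = 144 * (√k * (√L * √L)) := by ring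
      _ = 144 * (√k * L) := by rw [hs]
      _ ≤ 144 * (√k * (3 * Real.log n)) := by gcongr
      _ = 432 * Real.log n * √k := by ring

end MetricEmbedding

section MeanWidth

variable {k : ℕ}

/-- The restriction of a linear isometry to the unit sphere. -/
noncomputable def sphereMap (T : (EuclideanSpace ℝ (Fin k)) ≃ₗᵢ[ℝ] (EuclideanSpace ℝ (Fin k))) :
    Metric.sphere (0 : EuclideanSpace ℝ (Fin k)) 1 ≃ₜ Metric.sphere (0 : EuclideanSpace ℝ (Fin k)) 1 where
  toFun u := ⟨T u, by simp⟩
  invFun u := ⟨T.symm u, by simp⟩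
  left_inv u := by simp
  right_inv u := by simp
  continuous_toFun := by fun_prop
  continuous_invFun := by fun_prop

lemma coe_sphereMap (T : (EuclideanSpace ℝ (Fin k)) ≃ₗᵢ[ℝ] (EuclideanSpace ℝ (Fin k)))
    (u : Metric.sphere (0 : EuclideanSpace ℝ (Fin k)) 1) :
    (sphereMap T u : EuclideanSpace ℝ (Fin k)) = T u := rfl

lemma measurePreserving_sphereMap (T : (EuclideanSpace ℝ (Fin k)) ≃ₗᵢ[ℝ] (EuclideanSpace ℝ (Fin k))) :
    MeasurePreserving (sphereMap T) (surfaceMeasure k) (surfaceMeasure k) := by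
  refine ⟨(sphereMap T).continuous.measurable, ?_⟩
  ext s hs
  rw [Measure.map_apply (sphereMap T).continuous.measurable hs, surfaceMeasure,
    Measure.toSphere_apply' _ hs,
    Measure.toSphere_apply' _ ((sphereMap T).continuous.measurable hs)]
  congr 1
  refine Eq.trans ?_ (T.measurePreserving.measure_preimage_equiv (f := T.toMeasurableEquiv) _)
  congr 1
  ext x
  simp only [Set.mem_smul, Set.mem_preimage, Set.mem_image]
  constructor
  · rintro ⟨r, hr, _, ⟨u, hu, rfl⟩, rfl⟩
    exact ⟨r, hr, _, ⟨sphereMap T u, hu, rfl⟩, by simp [coe_sphereMap]⟩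
  · rintro ⟨r, hr, _, ⟨u, hu, rfl⟩, h⟩
    refine ⟨r, hr, _, ⟨(sphereMap T).symm u, by simpa using hu, rfl⟩, ?_⟩
    apply T.injective
    have : T x = r • (u : EuclideanSpace ℝ (Fin k)) := h.symm
    simp [sphereMap, this]

lemma continuous_abs_inner_sphere (a : EuclideanSpace ℝ (Fin k)) :
    Continuous fun u : Metric.sphere (0 : EuclideanSpace ℝ (Fin k)) 1 => |inner ℝ a (u : EuclideanSpace ℝ (Fin k))| := by
  fun_prop

instance : IsFiniteMeasure (surfaceMeasure k) := by
  unfold surfaceMeasure; infer_instance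

lemma integrable_of_continuous_sphere {f : Metric.sphere (0 : EuclideanSpace ℝ (Fin k)) 1 → ℝ} (hf : Continuous f) :
    Integrable f (surfaceMeasure k) :=
  hf.integrable_of_hasCompactSupport (HasCompactSupport.of_compactSpace f)

lemma integral_abs_inner_eq_of_norm_eq {a b : EuclideanSpace ℝ (Fin k)} (h : ‖a‖ = ‖b‖) :
    ∫ u, |inner ℝ a (u : EuclideanSpace ℝ (Fin k))| ∂surfaceMeasure k =
      ∫ u, |inner ℝ b (u : EuclideanSpace ℝ (Fin k))| ∂surfaceMeasure k := by
  set T := (Submodule.span ℝ {a - b})ᗮ.reflection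
  have hT : T a = b := Submodule.reflection_sub h
  rw [← (measurePreserving_sphereMap T).integral_comp (sphereMap T).measurableEmbedding
    fun u => |inner ℝ b (u : EuclideanSpace ℝ (Fin k))|]
  simp only [coe_sphereMap, ← hT, LinearIsometryEquiv.inner_map_map]

lemma integral_abs_inner_ge (hk : 0 < k) (a : EuclideanSpace ℝ (Fin k)) :
    ‖a‖ / (50 * √k) * (surfaceMeasure k).real Set.univ ≤
      ∫ u, |inner ℝ a (u : EuclideanSpace ℝ (Fin k))| ∂surfaceMeasure k := by
  have hk' : (0 : ℝ) < k := by exact_mod_cast hk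
  have hs : 0 < √(k : ℝ) := Real.sqrt_pos.2 hk'
  set c : ℝ := ‖a‖ / √k with hc
  have hc0 : 0 ≤ c := by positivity
  set b : (Fin k → Bool) → EuclideanSpace ℝ (Fin k) := fun ε => WithLp.toLp 2 fun i => c * boolSign (ε i) with hb
  have hnorm : ∀ ε, ‖a‖ = ‖b ε‖ := by
    intro ε
    rw [EuclideanSpace.norm_eq (b ε)]
    have hsq : ∀ β : Bool, boolSign β ^ 2 = 1 := fun β => by rw [sq, boolSign_mul_self]
    simp only [hb, Real.norm_eq_abs, sq_abs, mul_pow, hsq]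
    simp only [mul_one, Finset.sum_const, Finset.card_univ, Fintype.card_fin, nsmul_eq_mul]
    rw [hc, div_pow, Real.sq_sqrt hk'.le, mul_div_cancel₀ _ hk'.ne', Real.sqrt_sq (norm_nonneg a)]
  have hinner : ∀ ε (u : EuclideanSpace ℝ (Fin k)), |inner ℝ (b ε) u| = c * |signedSum (fun i => u i) ε| := by
    intro ε u
    nth_rewrite 1 [← abs_of_nonneg hc0]
    rw [← abs_mul, PiLp.inner_apply, signedSum, Finset.mul_sum]
    congr 1
    refine Finset.sum_congr rfl fun i _ => ?_
    simp [hb]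
    ring
  have h1 : ∫ u, |inner ℝ a (u : EuclideanSpace ℝ (Fin k))| ∂surfaceMeasure k =
      signAverage fun ε => ∫ u, |inner ℝ (b ε) (u : EuclideanSpace ℝ (Fin k))| ∂surfaceMeasure k := by
    rw [← signAverage_const (ι := Fin k) (∫ u, |inner ℝ a (u : EuclideanSpace ℝ (Fin k))| ∂surfaceMeasure k)]
    congr 1
    funext ε
    exact integral_abs_inner_eq_of_norm_eq (hnorm ε)
  have h2 : (signAverage fun ε => ∫ u, |inner ℝ (b ε) (u : EuclideanSpace ℝ (Fin k))| ∂surfaceMeasure k) =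
      ∫ u, (signAverage fun ε => |inner ℝ (b ε) (u : EuclideanSpace ℝ (Fin k))|) ∂surfaceMeasure k := by
    simp only [signAverage]
    rw [integral_div, integral_finsetSum]
    exact fun ε _ => integrable_of_continuous_sphere (continuous_abs_inner_sphere _)
  rw [h1, h2]
  have h3 : ∫ _u, ‖a‖ / (50 * √k) ∂surfaceMeasure k =
      ‖a‖ / (50 * √k) * (surfaceMeasure k).real Set.univ := by
    rw [integral_const, smul_eq_mul, mul_comm]
  rw [← h3]
  refine integral_mono (integrable_const _) (integrable_of_continuous_sphere ?_) fun u => ?_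
  · unfold signAverage
    exact (continuous_finsetSum _ fun ε _ => continuous_abs_inner_sphere _).div_const _
  · have hu : ∑ i, (u : EuclideanSpace ℝ (Fin k)) i ^ 2 = 1 := by
      have := EuclideanSpace.real_norm_sq_eq (u : EuclideanSpace ℝ (Fin k))
      rw [← this]
      simp
    have := mul_le_mul_of_nonneg_left (khintchine_unit hu) hc0
    simp only [hinner, signAverage_const_mul]
    refine le_trans (le_of_eq ?_) this
    rw [hc]
    field_simp

lemma directionalWidth_convexHull {A : Finset (EuclideanSpace ℝ (Fin k))} (hA : A.Nonempty) (u : EuclideanSpace ℝ (Fin k)) :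
    directionalWidth (convexHull ℝ (A : Set (EuclideanSpace ℝ (Fin k)))) u =
      A.sup' hA (fun a => inner ℝ a u) - A.inf' hA (fun a => inner ℝ a u) := by
  have hlin : IsLinearMap ℝ fun a : EuclideanSpace ℝ (Fin k) => inner ℝ a u :=
    ⟨fun a b => inner_add_left a b u, fun c a => by simp [inner_smul_left]⟩
  unfold directionalWidth
  congr 1
  · refine IsGreatest.csSup_eq ⟨?_, ?_⟩
    · obtain ⟨a, ha, h⟩ := A.exists_mem_eq_sup' hA fun a => inner ℝ a u
      exact ⟨a, subset_convexHull ℝ _ ha, h.symm⟩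
    · rintro _ ⟨a, ha, rfl⟩
      exact convexHull_min (t := {a | inner ℝ a u ≤ A.sup' hA fun a => inner ℝ a u})
        (fun a ha => Finset.le_sup' (fun a => inner ℝ a u) ha)
        (convex_halfSpace_le hlin _) ha
  · refine IsLeast.csInf_eq ⟨?_, ?_⟩
    · obtain ⟨a, ha, h⟩ := A.exists_mem_eq_inf' hA fun a => inner ℝ a u
      exact ⟨a, subset_convexHull ℝ _ ha, h.symm⟩
    · rintro _ ⟨a, ha, rfl⟩
      exact convexHull_min (t := {a | A.inf' hA (fun a => inner ℝ a u) ≤ inner ℝ a u})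
        (fun a ha => Finset.inf'_le (fun a => inner ℝ a u) ha)
        (convex_halfSpace_ge hlin _) ha

lemma continuous_directionalWidth {A : Finset (EuclideanSpace ℝ (Fin k))} (hA : A.Nonempty) :
    Continuous fun u : Metric.sphere (0 : EuclideanSpace ℝ (Fin k)) 1 =>
      directionalWidth (convexHull ℝ (A : Set (EuclideanSpace ℝ (Fin k)))) u := by
  simp only [directionalWidth_convexHull hA]
  exact (Continuous.finset_sup'_apply hA fun a _ => by fun_prop).sub
    (Continuous.finset_inf'_apply hA fun a _ => by fun_prop)

/-- The factor relating the mean-width diversity to the average width over directions. -/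
noncomputable def meanWidthScale (k : ℕ) : ℝ :=
  Real.pi * (1 / (surfaceMeasure (k + 1)).real Set.univ) * (surfaceMeasure k).real Set.univ

lemma surfaceMeasure_real_univ_pos (hk : 0 < k) : 0 < (surfaceMeasure k).real Set.univ := by
  have : Nontrivial (EuclideanSpace ℝ (Fin k)) := by
    have : Nonempty (Fin k) := ⟨⟨0, hk⟩⟩
    infer_instance
  have h : surfaceMeasure k ≠ 0 := Measure.toSphere_ne_zero _
  have : NeZero (surfaceMeasure k) := ⟨h⟩
  exact measureReal_univ_pos

lemma meanWidthScale_pos (hk : 0 < k) : 0 < meanWidthScale k := by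
  have h1 := surfaceMeasure_real_univ_pos hk
  have h2 := surfaceMeasure_real_univ_pos (Nat.succ_pos k)
  have := Real.pi_pos
  unfold meanWidthScale
  positivity

lemma meanWidthDiversity_le (hk : 0 < k) {A : Finset (EuclideanSpace ℝ (Fin k))} {M : ℝ} (hM : 0 ≤ M)
    (h : ∀ a ∈ A, ∀ b ∈ A, dist a b ≤ M) :
    meanWidthDiversity k A ≤ meanWidthScale k * M := by
  have h1 := surfaceMeasure_real_univ_pos (Nat.succ_pos k)
  have hpi := Real.pi_pos
  rcases A.eq_empty_or_nonempty with rfl | hA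
  · have := meanWidthScale_pos hk
    simp only [meanWidthDiversity, absoluteMeanWidth, directionalWidth]
    simp
    positivity
  · unfold meanWidthDiversity absoluteMeanWidth meanWidthScale
    rw [← mul_assoc, mul_assoc (_ * _) _ M]
    refine mul_le_mul_of_nonneg_left ?_ (by positivity)
    rw [← smul_eq_mul, ← integral_const]
    refine integral_mono (integrable_of_continuous_sphere (continuous_directionalWidth hA))
      (integrable_const _) fun u => ?_
    simp only [directionalWidth_convexHull hA]
    obtain ⟨a, ha, ha'⟩ := A.exists_mem_eq_sup' hA fun a => inner ℝ a (u : EuclideanSpace ℝ (Fin k))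
    obtain ⟨b, hb, hb'⟩ := A.exists_mem_eq_inf' hA fun a => inner ℝ a (u : EuclideanSpace ℝ (Fin k))
    rw [ha', hb', ← inner_sub_left]
    have := real_inner_le_norm (a - b) (u : EuclideanSpace ℝ (Fin k))
    rw [norm_eq_of_mem_sphere, mul_one, ← dist_eq_norm] at this
    exact this.trans (h a ha b hb)

lemma le_meanWidthDiversity (hk : 0 < k) {A : Finset (EuclideanSpace ℝ (Fin k))} {a b : EuclideanSpace ℝ (Fin k)}
    (ha : a ∈ A) (hb : b ∈ A) :
    meanWidthScale k * (dist a b / (50 * √k)) ≤ meanWidthDiversity k A := by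
  have h1 := surfaceMeasure_real_univ_pos (Nat.succ_pos k)
  have hpi := Real.pi_pos
  have hA : A.Nonempty := ⟨a, ha⟩
  unfold meanWidthDiversity absoluteMeanWidth meanWidthScale
  rw [← mul_assoc, mul_assoc (_ * _) _ (_ / _)]
  refine mul_le_mul_of_nonneg_left ?_ (by positivity)
  rw [mul_comm, dist_eq_norm]
  refine (integral_abs_inner_ge hk (a - b)).trans ?_
  refine integral_mono (integrable_of_continuous_sphere (continuous_abs_inner_sphere _))
    (integrable_of_continuous_sphere (continuous_directionalWidth hA)) fun u => ?_
  simp only [directionalWidth_convexHull hA, inner_sub_left]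
  have ha1 := Finset.le_sup' (fun a => inner ℝ a (u : EuclideanSpace ℝ (Fin k))) ha
  have hb1 := Finset.le_sup' (fun a => inner ℝ a (u : EuclideanSpace ℝ (Fin k))) hb
  have ha2 := Finset.inf'_le (fun a => inner ℝ a (u : EuclideanSpace ℝ (Fin k))) ha
  have hb2 := Finset.inf'_le (fun a => inner ℝ a (u : EuclideanSpace ℝ (Fin k))) hb
  rw [abs_le]
  constructor <;> linarith

end MeanWidth

namespace IsDiversity

variable {X : Type*} [DecidableEq X] {δ : Finset X → ℝ}

lemma le_insert (h : IsDiversity δ) (b : X) (A : Finset X) : δ A ≤ δ (insert b A) := by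
  have h1 := h.triangle A {b} ∅ (Finset.singleton_nonempty b)
  rw [Finset.union_empty, Finset.union_empty, h.eq_zero_of_card_le_one {b} (by simp),
    Finset.union_singleton] at h1
  linarith

lemma mono (h : IsDiversity δ) {A B : Finset X} (hAB : A ⊆ B) : δ A ≤ δ B := by
  have key : ∀ C : Finset X, δ A ≤ δ (C ∪ A) := by
    intro C
    induction C using Finset.induction_on with
    | empty => simp
    | insert b C _ ih =>
      rw [Finset.insert_union]
      exact ih.trans (h.le_insert b _)
  have := key B
  rwa [Finset.union_eq_left.2 hAB] at this

lemma le_card_mul (h : IsDiversity δ) {M : ℝ} (hM : 0 ≤ M) (A : Finset X)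
    (hA : ∀ a ∈ A, ∀ b ∈ A, δ {a, b} ≤ M) : δ A ≤ A.card * M := by
  induction A using Finset.induction_on with
  | empty => simp [h.eq_zero_of_card_le_one ∅ (by simp)]
  | insert b A hb ih =>
    rw [Finset.card_insert_of_notMem hb]
    push_cast
    rcases A.eq_empty_or_nonempty with rfl | ⟨a, ha⟩
    · rw [h.eq_zero_of_card_le_one _ (by simp)]
      simpa using hM
    · have h1 := h.triangle A {a} {b} (Finset.singleton_nonempty a)
      rw [Finset.union_eq_left.2 (Finset.singleton_subset_iff.2 ha), Finset.union_singleton,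
        ← Finset.insert_eq] at h1
      have h2 := ih fun x hx y hy =>
        hA x (Finset.mem_insert_of_mem hx) y (Finset.mem_insert_of_mem hy)
      have h3 := hA a (Finset.mem_insert_of_mem ha) b (Finset.mem_insert_self b A)
      linarith

/-- The pseudometric induced by a diversity. -/
abbrev inducedMetric (h : IsDiversity δ) : PseudoMetricSpace X where
  dist x y := δ {x, y}
  dist_self x := h.eq_zero_of_card_le_one _ (by simp)
  dist_comm x y := by rw [Finset.pair_comm]
  dist_triangle x y z := by
    simpa only [← Finset.insert_eq] using
      h.triangle {x} {y} {z} (Finset.singleton_nonempty y)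

end IsDiversity

open Classical in
lemma hasDistortion_of_diameter_bounds {X Y : Type*} [Fintype X] {δ : Finset X → ℝ}
    (h : IsDiversity δ) {δY : Finset Y → ℝ} {φ : X → Y} {lo hi c : ℝ} (hlo : 0 < lo)
    (hhi : 0 < hi) (hc : 1 ≤ c) (hbound : Fintype.card X * hi ≤ c * lo)
    (hnonneg : ∀ A, 0 ≤ δY A)
    (hlower : ∀ (B : Finset Y) (a b : X), φ a ∈ B → φ b ∈ B → lo * δ {a, b} ≤ δY B)
    (hupper : ∀ (A : Finset X) (B : Finset Y) (M : ℝ), (∀ y ∈ B, ∃ a ∈ A, φ a = y) → 0 ≤ M →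
      (∀ a ∈ A, ∀ b ∈ A, δ {a, b} ≤ M) → δY B ≤ hi * M) :
    HasDistortion δ δY φ c := by
  have hc0 : 0 < c := by linarith
  refine ⟨hc, c / hi, hi, by positivity, hhi, by field_simp, fun A => ⟨?_, ?_⟩⟩
  · have h1 := hnonneg (A.image φ)
    have h2 := h.le_card_mul (M := δY (A.image φ) / lo) (by positivity) A fun a ha b hb => by
      rw [le_div_iff₀ hlo, mul_comm]
      exact hlower _ a b (Finset.mem_image_of_mem φ ha) (Finset.mem_image_of_mem φ hb)
    have h3 : (A.card : ℝ) ≤ Fintype.card X := by exact_mod_cast A.card_le_univ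
    rw [one_div_div, div_mul_eq_mul_div, div_le_iff₀ hc0]
    calc hi * δ A ≤ hi * (Fintype.card X * (δY (A.image φ) / lo)) := by
          refine mul_le_mul_of_nonneg_left (h2.trans ?_) hhi.le
          gcongr
      _ = Fintype.card X * hi * (δY (A.image φ) / lo) := by ring
      _ ≤ c * lo * (δY (A.image φ) / lo) := by gcongr
      _ = δY (A.image φ) * c := by field_simp
  · refine hupper A _ (δ A) (fun y hy => Finset.mem_image.1 hy) (h.nonneg A) fun a ha b hb => h.mono ?_
    intro x hx
    rcases Finset.mem_insert.1 hx with rfl | hx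
    · exact ha
    · rwa [Finset.mem_singleton.1 hx]

lemma l1Diversity_nonneg (k : ℕ) (A : Finset (Fin k → ℝ)) : 0 ≤ l1Diversity k A :=
  Finset.sum_nonneg fun _ _ => NNReal.coe_nonneg _

lemma dist_le_l1Diversity {k : ℕ} {A : Finset (Fin k → ℝ)} {a b : EuclideanSpace ℝ (Fin k)}
    (ha : a.ofLp ∈ A) (hb : b.ofLp ∈ A) : dist a b ≤ l1Diversity k A := by
  have h1 : dist a b ≤ ∑ i, |a i - b i| := by
    rw [EuclideanSpace.dist_eq]
    refine (Real.sqrt_le_left (Finset.sum_nonneg fun _ _ => abs_nonneg _)).2 ?_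
    simp only [Real.dist_eq]
    exact Finset.sum_sq_le_sq_sum_of_nonneg fun i _ => abs_nonneg _
  refine h1.trans (Finset.sum_le_sum fun i _ => ?_)
  have := Finset.le_sup (f := fun p : (Fin k → ℝ) × (Fin k → ℝ) => ‖p.1 i - p.2 i‖₊)
    (Finset.mk_mem_product ha hb)
  exact_mod_cast this

lemma l1Diversity_le {k : ℕ} {A : Finset (Fin k → ℝ)} {M : ℝ} (hM : 0 ≤ M)
    (h : ∀ a ∈ A, ∀ b ∈ A, dist (WithLp.toLp 2 a : EuclideanSpace ℝ (Fin k)) (WithLp.toLp 2 b) ≤ M) :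
    l1Diversity k A ≤ k * M := by
  have : ∀ i ∈ (Finset.univ : Finset (Fin k)),
      (((A ×ˢ A).sup fun p => ‖p.1 i - p.2 i‖₊ : NNReal) : ℝ) ≤ M := by
    intro i _
    lift M to NNReal using hM
    rw [NNReal.coe_le_coe]
    refine Finset.sup_le fun p hp => ?_
    have h1 := h p.1 (Finset.mem_product.1 hp).1 p.2 (Finset.mem_product.1 hp).2
    rw [dist_eq_norm] at h1
    have h2 := (PiLp.norm_apply_le _ i).trans h1
    exact_mod_cast h2
  simpa [l1Diversity] using Finset.sum_le_sum this

lemma meanWidthDiversity_nonneg {k : ℕ} (hk : 0 < k) (A : Finset (EuclideanSpace ℝ (Fin k))) :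
    0 ≤ meanWidthDiversity k A := by
  rcases A.eq_empty_or_nonempty with rfl | ⟨a, ha⟩
  · simp [meanWidthDiversity, absoluteMeanWidth, directionalWidth]
  · simpa using le_meanWidthDiversity hk ha ha

theorem mainTheorem8 :
    ∃ C : ℝ, 0 < C ∧
      ∀ (X : Type*) [Fintype X] (δ : Finset X → ℝ), IsDiversity δ → 2 ≤ Fintype.card X →
        (∃ (k : ℕ) (φ : X → (Fin k → ℝ)) (c : ℝ),
          (k : ℝ) ≤ C * Real.log (Fintype.card X) ∧
          HasDistortion δ (l1Diversity k) φ c ∧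
          c ≤ C * ((Fintype.card X : ℝ) * Real.log (Fintype.card X) ^ 2)) ∧
        (∃ (k : ℕ) (φ : X → EuclideanSpace ℝ (Fin k)) (c : ℝ),
          (k : ℝ) ≤ C * Real.log (Fintype.card X) ∧
          HasDistortion δ (meanWidthDiversity k) φ c ∧
          c ≤ C * ((Fintype.card X : ℝ) *
            Real.log (Fintype.card X) ^ (3 / 2 : ℝ))) := by
  classical
  refine ⟨1000000, by norm_num, fun X _ δ h hn => ?_⟩
  let _ : PseudoMetricSpace X := h.inducedMetric
  obtain ⟨k, f, α, hk, hkn, hα, hf⟩ := exists_euclidean_embedding hn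
  have hdist : ∀ x y : X, dist x y = δ {x, y} := fun _ _ => rfl
  simp only [hdist] at hf
  obtain ⟨hlog, -⟩ := card_log_bounds hn
  have hn2 : (2 : ℝ) ≤ Fintype.card X := by exact_mod_cast hn
  set n : ℝ := (Fintype.card X : ℝ) with hndef
  set ℓ : ℝ := Real.log n with hℓ
  have hℓ0 : 0 < ℓ := by linarith
  have hk0 : (0 : ℝ) < k := by exact_mod_cast hk
  have hkC : (k : ℝ) ≤ 1000000 * ℓ := by linarith
  have hup : ∀ (A : Finset X) (M : ℝ), (∀ a ∈ A, ∀ b ∈ A, δ {a, b} ≤ M) →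
      ∀ a ∈ A, ∀ b ∈ A, dist (f a) (f b) ≤ 432 * ℓ * α * M := fun A M hM a ha b hb =>
    (hf a b).2.trans (mul_le_mul_of_nonneg_left (hM a ha b hb) (by positivity))
  refine ⟨⟨k, fun x => (f x).ofLp, 1000000 * (n * ℓ ^ 2), hkC, ?_, le_rfl⟩,
    ⟨k, f, 1000000 * (n * ℓ ^ (3 / 2 : ℝ)), hkC, ?_, le_rfl⟩⟩
  · refine hasDistortion_of_diameter_bounds h (lo := α) (hi := k * (432 * ℓ * α)) hα
      (by positivity) ?_ ?_ (l1Diversity_nonneg k) ?_ ?_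
    · nlinarith [mul_le_mul hlog hlog (by norm_num) hℓ0.le]
    · calc n * (k * (432 * ℓ * α)) ≤ n * (963 * ℓ * (432 * ℓ * α)) := by gcongr
        _ = 416016 * (n * ℓ ^ 2 * α) := by ring
        _ ≤ 1000000 * (n * ℓ ^ 2 * α) := by gcongr; norm_num
        _ = 1000000 * (n * ℓ ^ 2) * α := by ring
    · intro B a b ha hb
      exact (hf a b).1.trans (dist_le_l1Diversity ha hb)
    · intro A B M hB hM hA
      rw [mul_assoc]
      refine l1Diversity_le (by positivity) fun y hy z hz => ?_
      obtain ⟨a, ha, rfl⟩ := hB y hy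
      obtain ⟨b, hb, rfl⟩ := hB z hz
      exact hup A M hA a ha b hb
  · have hw := meanWidthScale_pos hk
    have hs : 0 < √(k : ℝ) := Real.sqrt_pos.2 hk0
    have hpow : ℓ ^ (3 / 2 : ℝ) = ℓ * √ℓ := by
      rw [Real.sqrt_eq_rpow, ← Real.rpow_one_add' hℓ0.le (by norm_num)]
      norm_num
    have hsl : 2 / 3 ≤ √ℓ := Real.le_sqrt_of_sq_le (by linarith)
    have hsk : √(k : ℝ) ≤ 32 * √ℓ := by
      rw [Real.sqrt_le_left (by positivity), mul_pow, Real.sq_sqrt hℓ0.le]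
      linarith
    rw [hpow]
    refine hasDistortion_of_diameter_bounds h (lo := meanWidthScale k * (α / (50 * √k)))
      (hi := meanWidthScale k * (432 * ℓ * α)) (by positivity)
      (by positivity) ?_ ?_ (meanWidthDiversity_nonneg hk) ?_ ?_
    · nlinarith [mul_le_mul hlog hsl (by norm_num) hℓ0.le]
    · rw [← hndef, mul_div_assoc', mul_div_assoc', le_div_iff₀ (by positivity)]
      calc n * (meanWidthScale k * (432 * ℓ * α)) * (50 * √k)
          = 21600 * n * ℓ * (meanWidthScale k * α) * √k := by ring
        _ ≤ 21600 * n * ℓ * (meanWidthScale k * α) * (32 * √ℓ) := by gcongr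
        _ = 691200 * (n * (ℓ * √ℓ) * (meanWidthScale k * α)) := by ring
        _ ≤ 1000000 * (n * (ℓ * √ℓ) * (meanWidthScale k * α)) := by gcongr; norm_num
        _ = 1000000 * (n * (ℓ * √ℓ)) * (meanWidthScale k * α) := by ring
    · intro B a b ha hb
      refine le_trans ?_ (le_meanWidthDiversity hk ha hb)
      rw [mul_assoc, div_mul_eq_mul_div]
      gcongr
      exact (hf a b).1
    · intro A B M hB hM hA
      rw [mul_assoc]
      refine meanWidthDiversity_le hk (by positivity) fun y hy z hz => ?_
      obtain ⟨a, ha, rfl⟩ := hB y hy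
      obtain ⟨b, hb, rfl⟩ := hB z hz
      exact hup A M hA a ha b hb
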